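/- Let $H$ be a real separable Hilbert space with inner product $\langle\cdot,\cdot\rangle$ and norm $|\cdot|$, let $\bar y\in H$ with $|\bar y|=1$, and set $H_+=\{x\in H:\langle x,\bar y\rangle>0\}$, with closure $\overline{H_+}$. Let $Q$ be a positive (that is, non-negative), self-adjoint, trace class operator on $H$, and assume: 1. $A\colon D(A)\subset H\to H$ is the generator of a $C_0$-semigroup $(e^{tA})_{t\ge0}$ on $H$; 2. there is $\alpha\in\mathbb R$ with $A\bar y=\alpha\bar y$ and $A^*\bar y=\alpha\bar y$; 3. there is $\lambda>0$ with $Q\bar y=\lambda\bar y$; 4. $e^{tA}Q=Qe^{tA}$ for all $t\ge 0$; 5. $Q_t:=\int_0^t e^{sA}Qe^{sA^*}\,ds$ is of trace class for all $t>0$; 6. there is $\gamma\in(0,1)$ such that $\int_0^t s^{-\gamma}e^{sA}Qe^{sA^*}\,ds$ is of trace class for all $t>0$; 7. $\operatorname{Im} e^{tA}\subset \operatorname{Im} Q_t^{1/2}$ for all $t>0$. Let $T>0$ and $\delta\in(0,1)$, and assume that there is a constant $K>0$ with $\|Q_t^{-1/2}e^{tA}\|_{\mathcal L(H)}\le K t^{-\delta}$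 for all $t\in(0,T]$, where $Q_t^{-1/2}$ is the pseudoinverse of $Q_t^{1/2}$. For bounded Borel $g\colon H\to\mathbb R$ and $t>0$ put $T_tg(x)=\int_H g(y)\,\mathcal N(e^{tA}x,Q_t)(dy)$, $x\in H$, where $\mathcal N(m,B)$ is the Gaussian measure on $H$ with mean $m$ and covariance operator $B$. For $f$ in the space $B_b(H_+)$ of bounded Borel functions $f\colon H_+\to\mathbb R$, let $Ef\colon H\to\mathbb R$ be its odd extension: $Ef(x)=f(x)$ if $\langle x,\bar y\rangle>0$, $Ef(x)=0$ if $\langle x,\bar y\rangle=0$, and $Ef(x)=-f(x-2\langle x,\bar y\rangle\bar y)$ if $\langle x,\bar y\rangle<0$. Let $P_tf\colon\overline{H_+}\to\mathbb R$ be the restriction of $T_tEf$ to $\overline{H_+}$. Then there is a constant $C>0$ such that, for every $f\in B_b(H_+)$ and every $t\in(0,T]$, the function $P_tf$ belongs to $UC^1_b(\overline{H_+})$, that is, $P_tf$ is Fréchet differentiable on $\overline{H_+}$ (relative to $\overline{H_+}$ at boundary points), and $P_tf$ and its gradient $DP_tf$ are bounded and uniformly continuous on $\overline{H_+}$; moreover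 $$|DP_tf(x)|\le \frac{C}{t^{\delta}}\,\sup_{z\in H_+}|f(z)|\qquad\text{for all }x\in H_+.$$ -/

import Mathlib

open MeasureTheory Filter Topology Set
open scoped RealInnerProductSpace

noncomputable section

namespace HalfSpaceOU

/-! Function spaces. -/

/-- The set of bounded Borel measurable real functions on `X`. -/
def IsBoundedMeasurable {X : Type*} [MeasurableSpace X] (f : X → ℝ) : Prop :=
  Measurable f ∧ ∃ M : ℝ, ∀ x, |f x| ≤ M

/-- The supremum norm (used only for bounded functions on a nonempty space). -/
def supNorm {X : Type*} (f : X → ℝ) : ℝ := ⨆ x, |f x|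

variable {H : Type*} [NormedAddCommGroup H] [InnerProductSpace ℝ H]

/-! The half-space. -/

/-- The open half-space `H_+` of the vectors `x` with positive first coordinate `⟨x, ȳ⟩`. -/
def halfSpace (ybar : H) : Set H := {x | 0 < ⟪x, ybar⟫}

/-- The reflection `(x₁, x') ↦ (-x₁, x')`, for a unit vector `ȳ`. -/
def reflect (ybar x : H) : H := x - (2 * ⟪x, ybar⟫) • ybar

open Classical in
/-- The odd extension to `H` of a function on the open half-space, null on the boundary.
(For a unit vector `ȳ`, the reflection of `x` lies in the open half-space exactly when the first
coordinate of `x` is negative.) -/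
def oddExt (ybar : H) (f : halfSpace ybar → ℝ) (x : H) : ℝ :=
  if h : x ∈ halfSpace ybar then f ⟨x, h⟩
  else if h : reflect ybar x ∈ halfSpace ybar then -f ⟨reflect ybar x, h⟩
  else 0

theorem reflect_mem_halfSpace_iff {ybar : H} (hy : ‖ybar‖ = 1) (x : H) :
    reflect ybar x ∈ halfSpace ybar ↔ ⟪x, ybar⟫ < 0 := by
  have h1 : ⟪ybar, ybar⟫ = 1 := by rw [real_inner_self_eq_norm_sq, hy]; norm_num
  simp only [reflect, halfSpace, Set.mem_ofPred_eq, inner_sub_left, real_inner_smul_left, h1]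
  constructor <;> intro h <;> linarith

variable [CompleteSpace H]

/-! Spaces of differentiable functions. -/

/-- The gradient (Riesz representative of the Fréchet derivative) of a function `u` defined on
a subset `s` of `H`. The derivative is taken relative to `s`, so it only involves the values of `u`,
and the value `0` given to the extension of `u` outside `s` plays no role. At interior points of `s`
this is the usual Fréchet derivative. -/
def gradOn {s : Set H} (u : s → ℝ) (x : s) : H :=
  gradientWithin (Function.extend Subtype.val u 0) s (x : H)

/-- The space of real functions on `s` that are bounded and uniformly continuous on `s` together
with their first order Fréchet derivative. -/
structure IsUCb1 {s : Set H} (u : s → ℝ) : Prop where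
  bounded : ∃ M : ℝ, ∀ x, |u x| ≤ M
  uniformContinuous : UniformContinuous u
  differentiable : DifferentiableOn ℝ (Function.extend Subtype.val u 0) s
  grad_bounded : ∃ M : ℝ, ∀ x, ‖gradOn u x‖ ≤ M
  grad_uniformContinuous : UniformContinuous (gradOn u)

/-! Semigroups and operators. -/

/-- `S` restricted to `[0, ∞)` is a strongly continuous semigroup of bounded linear operators
(the values of `S` at negative times are irrelevant). -/
structure IsC0Semigroup (S : ℝ → H →L[ℝ] H) : Prop where
  zero : S 0 = ContinuousLinearMap.id ℝ H
  add : ∀ s t : ℝ, 0 ≤ s → 0 ≤ t → S (s + t) = S s ∘L S t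
  tendsto_zero : ∀ x : H, Tendsto (fun t : ℝ => S t x) (𝓝[>] 0) (𝓝 x)

/-- The (possibly unbounded) operator `A` is the infinitesimal generator of `S`: its domain
consists of the `x` for which `lim_{t → 0+} (S t x - x) / t` exists, and `A x` is that limit. -/
def IsGenerator (A : H →ₗ.[ℝ] H) (S : ℝ → H →L[ℝ] H) : Prop :=
  ∀ x y : H, (x, y) ∈ A.graph ↔ Tendsto (fun t : ℝ => t⁻¹ • (S t x - x)) (𝓝[>] 0) (𝓝 y)

/-- Trace class (nuclear) operators: `B x = ∑ ⟨a n, x⟩ b n` with `∑ ‖a n‖ ‖b n‖ < ∞`. -/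
def IsTraceClass (B : H →L[ℝ] H) : Prop :=
  ∃ a b : ℕ → H, Summable (fun n => ‖a n‖ * ‖b n‖) ∧
    ∀ x : H, HasSum (fun n => ⟪a n, x⟫ • b n) (B x)

open Classical in
/-- The square root of a positive self-adjoint operator `B`: the unique positive self-adjoint `R`
with `R ∘ R = B`. -/
def posSqrt (B : H →L[ℝ] H) : H →L[ℝ] H :=
  if h : ∃ R : H →L[ℝ] H, R.IsPositive ∧ R ∘L R = B then h.choose else 0

open Classical in
/-- The pseudoinverse of `R` on the range of `R`: for `y` in the range, the unique `z` orthogonal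
to the kernel of `R` with `R z = y`, which is the preimage of `y` of minimal norm. -/
def pseudoInv (R : H →L[ℝ] H) (y : H) : H :=
  if h : ∃ z : H, (∀ w : H, R w = 0 → ⟪w, z⟫ = 0) ∧ R z = y then h.choose else 0

/-- A preimage orthogonal to the kernel exists for every `y` in the range, so that the junk
value in `pseudoInv` is taken only outside the range. -/
theorem pseudoInv_spec (R : H →L[ℝ] H) {y : H} (hy : y ∈ Set.range R) :
    (∀ w : H, R w = 0 → ⟪w, pseudoInv R y⟫ = 0) ∧ R (pseudoInv R y) = y := by
  have h : ∃ z : H, (∀ w : H, R w = 0 → ⟪w, z⟫ = 0) ∧ R z = y := by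
    obtain ⟨x, rfl⟩ := hy
    have : CompleteSpace R.ker := R.isClosed_ker.completeSpace_coe
    obtain ⟨a, ha, b, hb, rfl⟩ := R.ker.exists_add_mem_mem_orthogonal x
    refine ⟨b, fun w hw => hb w hw, ?_⟩
    have : R a = 0 := ha
    simp [this]
  unfold pseudoInv
  rw [dif_pos h]
  exact h.choose_spec

/-- The integrand `e^{sA} Q e^{sA*}`. When `Q` is of trace class, hence compact, it is
continuous in `s ≥ 0` for the operator norm, so that it can be integrated in the Banach space of
bounded operators. -/
def covIntegrand (S : ℝ → H →L[ℝ] H) (Q : H →L[ℝ] H) (s : ℝ) : H →L[ℝ] H :=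
  S s ∘L Q ∘L ContinuousLinearMap.adjoint (S s)

/-- The covariance operator `Q_t = ∫₀ᵗ e^{sA} Q e^{sA*} ds`. -/
def covOp (S : ℝ → H →L[ℝ] H) (Q : H →L[ℝ] H) (t : ℝ) : H →L[ℝ] H :=
  ∫ s in (0 : ℝ)..t, covIntegrand S Q s

/-! Gaussian measures and the transition semigroups. -/

/-- `μ` is the Gaussian measure with mean `m` and covariance operator `B`, through its
characteristic function. -/
def IsGaussianWith [MeasurableSpace H] (m : H) (B : H →L[ℝ] H) (μ : Measure H) : Prop :=
  IsProbabilityMeasure μ ∧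
    ∀ h : H, charFun μ h = Complex.exp ((⟪m, h⟫ : ℝ) * Complex.I - ((⟪B h, h⟫ / 2 : ℝ) : ℂ))

/-- A Gaussian measure is determined by its mean and its covariance operator. -/
theorem IsGaussianWith.unique [TopologicalSpace.SeparableSpace H] [MeasurableSpace H]
    [BorelSpace H] {m : H} {B : H →L[ℝ] H} {μ ν : Measure H} (hμ : IsGaussianWith m B μ)
    (hν : IsGaussianWith m B ν) : μ = ν := by
  have h1 := hμ.1
  have h2 := hν.1
  have : SecondCountableTopology H := UniformSpace.secondCountable_of_separable H
  refine Measure.ext_of_charFun (funext fun h => ?_)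
  rw [hμ.2 h, hν.2 h]

open Classical in
/-- The Gaussian measure `N(m, B)` on `H`; for a positive self-adjoint trace class `B` it exists
and is unique. -/
def gaussian [MeasurableSpace H] (m : H) (B : H →L[ℝ] H) : Measure H :=
  if h : ∃ μ : Measure H, IsGaussianWith m B μ then h.choose else 0

/-- The Ornstein-Uhlenbeck semigroup `T_t f (x) = ∫ f dN(e^{tA} x, Q_t)`. -/
def ouSemigroup [MeasurableSpace H] (S : ℝ → H →L[ℝ] H) (Q : H →L[ℝ] H) (t : ℝ) (f : H → ℝ)
    (x : H) : ℝ :=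
  ∫ y, f y ∂(gaussian (S t x) (covOp S Q t))

/-- The semigroup `P_t = R T_t E` on the half-space: extend oddly, apply the Ornstein-Uhlenbeck
semigroup, restrict to the closed half-space. -/
def halfSemigroup [MeasurableSpace H] (S : ℝ → H →L[ℝ] H) (Q : H →L[ℝ] H) (ybar : H) (t : ℝ)
    (f : halfSpace ybar → ℝ) : closure (halfSpace ybar) → ℝ :=
  (closure (halfSpace ybar)).domRestrict (ouSemigroup S Q t (oddExt ybar f))

end HalfSpaceOU

end

/-!
The function `P_t f` is the restriction to the closed half-space of `T_t g`, where `g` is the odd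
extension of `f`, a bounded Borel function with the same supremum norm. The claim is therefore the
smoothing of the Ornstein-Uhlenbeck semigroup on the whole space: `T_t g` has a uniformly continuous
gradient, bounded by `K t ^ (-δ) sup |g|`.

Let `B` be the covariance `Q_t` and `R` its square root. Since `B` is positive and of trace class,
`R` exists (`posSqrt_spec`) and is Hilbert-Schmidt. An isonormal Gaussian process `W` on a product
of standard Gaussian laws (`isIsonormal_isonormalOfBasis`) then yields a random vector `X` in `H`
with `⟨X, h⟩ = W (R h)` (`exists_isImageOf`), so that the law of `X + m` is the Gaussian measure of
mean `m` and covariance `B` (`gaussian_eq_map_add`); in particular this measure exists. The range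
condition factors `e^{tA}` as `R ∘ Λ` with `‖Λ‖ ≤ K t ^ (-δ)` (`exists_factor_through`), whence
`T_t g x = F (Λ x)` with `F z = E[g (X + R z)]`.

By the Cameron-Martin formula (`IsIsonormal.integral_comp_add`), proved by comparing
characteristic functions, `F (z + w) = E[g (X + R z) exp (W w - ‖w‖² / 2)]`. The density
`exp (W w - ‖w‖² / 2)` is `1 + W w` up to an error of order `‖w‖²` in `L¹`, and `W` is an isometry
into `L²`. So `F` has at every `z` the first order Taylor expansion with derivative
`w ↦ E[g (X + R z) W w]`, of norm at most `sup |g|`, and with a remainder `O(‖w‖²)` uniform in `z`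
(`IsIsonormal.exists_taylor`). A function with such a uniform expansion has a uniformly continuous
derivative (`uniformContinuous_of_taylor`). No second derivative is needed.

Uniqueness of the derivative relative to the closed half-space, a convex set with nonempty interior,
identifies the gradient on the boundary (`isUCb1_restrict`).
-/

namespace HalfSpaceOU

open ProbabilityTheory
open scoped ENNReal NNReal

section Operators

variable {H : Type*} [NormedAddCommGroup H] [InnerProductSpace ℝ H]

/-! ### Trace class operators -/

/-- By Bessel's inequality the partial sums of the diagonal of `B` are at most `∑ ‖a n‖ ‖b n‖`. -/
lemma summable_inner_of_isTraceClass {B : H →L[ℝ] H} (hB : B.IsPositive) (htr : IsTraceClass B)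
    {ι : Type*} {e : ι → H} (he : Orthonormal ℝ e) : Summable fun i => ⟪B (e i), e i⟫ := by
  obtain ⟨a, b, hs, hab⟩ := htr
  refine summable_of_sum_le (c := ∑' n, ‖a n‖ * ‖b n‖) (fun i => hB.inner_nonneg_left _) fun s => ?_
  have h1 : HasSum (fun n => ∑ i ∈ s, ⟪a n, e i⟫ * ⟪b n, e i⟫) (∑ i ∈ s, ⟪B (e i), e i⟫) := by
    refine hasSum_sum fun i _ => ?_
    have := (innerSL ℝ (e i)).hasSum (hab (e i))
    simpa [Function.comp_def, inner_smul_right, real_inner_comm] using this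
  refine h1.tsum_eq ▸ h1.summable.tsum_le_tsum (fun n => ?_) hs
  have hbessel : ∀ x : H, ∑ i ∈ s, ⟪x, e i⟫ ^ 2 ≤ ‖x‖ ^ 2 := fun x => by
    simpa [real_inner_comm] using he.sum_inner_products_le x (s := s)
  refine abs_le_of_sq_le_sq' ?_ (by positivity) |>.2
  refine (Finset.sum_mul_sq_le_sq_mul_sq _ _ _).trans ?_
  rw [mul_pow]
  exact mul_le_mul (hbessel _) (hbessel _) (Finset.sum_nonneg fun _ _ => sq_nonneg _)
    (by positivity)

/-! ### Square roots of positive operators -/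

lemma catalan_succ_div_four_pow (n : ℕ) :
    (catalan (n + 1) : ℝ) / 4 ^ (n + 1) = (1 / 4) * ∑ p ∈ Finset.HasAntidiagonal.antidiagonal n,
      (catalan p.1 : ℝ) / 4 ^ p.1 * ((catalan p.2 : ℝ) / 4 ^ p.2) := by
  simp only [catalan_succ', Nat.cast_sum, Nat.cast_mul, Finset.mul_sum, Finset.sum_div]
  refine Finset.sum_congr rfl fun p hp => ?_
  rw [← Finset.HasAntidiagonal.mem_antidiagonal.1 hp, pow_succ, pow_add]
  field_simp

/-- The partial sums `s N` of `∑ Cₙ / 4ⁿ` satisfy `s (N + 1) ≤ 1 + (s N)² / 4` by the recursion of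
the Catalan numbers, and `2` is a fixed point of `x ↦ 1 + x² / 4`. -/
lemma sum_range_catalan_div_le (N : ℕ) :
    ∑ n ∈ Finset.range N, (catalan n : ℝ) / 4 ^ n ≤ 2 := by
  set b : ℕ → ℝ := fun n => (catalan n : ℝ) / 4 ^ n with hb
  have hb0 : ∀ n, 0 ≤ b n := fun n => by positivity
  change ∑ n ∈ Finset.range N, b n ≤ 2
  have hsucc : ∀ n, b (n + 1) =
      (1 / 4) * ∑ p ∈ Finset.HasAntidiagonal.antidiagonal n, b p.1 * b p.2 :=
    catalan_succ_div_four_pow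
  -- The pairs of sum less than `N` all lie in the square of side `N`.
  have hsq : ∀ N, ∑ n ∈ Finset.range N, ∑ p ∈ Finset.HasAntidiagonal.antidiagonal n,
      b p.1 * b p.2 ≤ (∑ n ∈ Finset.range N, b n) * ∑ n ∈ Finset.range N, b n := by
    intro N
    rw [Finset.sum_mul_sum, ← Finset.sum_product', Finset.sum_sigma']
    have himg : ∑ p ∈ (Finset.range N ×ˢ Finset.range N).filter (fun p => p.1 + p.2 < N),
        b p.1 * b p.2 =
        ∑ x ∈ (Finset.range N).sigma fun n => Finset.HasAntidiagonal.antidiagonal n,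
          b x.2.1 * b x.2.2 := by
      symm
      refine Finset.sum_nbij' (fun x => x.2) (fun p => ⟨p.1 + p.2, p⟩) ?_ ?_ ?_ ?_ ?_
      · rintro ⟨n, p⟩ h
        simp only [Finset.mem_sigma, Finset.mem_range, Finset.HasAntidiagonal.mem_antidiagonal,
          Finset.mem_filter, Finset.mem_product] at h ⊢
        omega
      · intro p h
        simpa using (Finset.mem_filter.1 h).2
      · rintro ⟨n, p⟩ h
        simp only [Finset.mem_sigma, Finset.HasAntidiagonal.mem_antidiagonal] at h
        simp [h.2]
      · intros; rfl
      · intros; rfl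
    rw [← himg]
    exact Finset.sum_le_sum_of_subset_of_nonneg (Finset.filter_subset _ _)
      fun p _ _ => mul_nonneg (hb0 _) (hb0 _)
  induction N with
  | zero => simp
  | succ N ih =>
    rw [Finset.sum_range_succ']
    have h0 : b 0 = 1 := by simp [hb]
    have hs0 : 0 ≤ ∑ n ∈ Finset.range N, b n := Finset.sum_nonneg fun n _ => hb0 n
    simp only [hsucc, ← Finset.mul_sum, h0]
    nlinarith [hsq N]

lemma norm_le_one_of_inner_le {X : H →L[ℝ] H} (hX : X.IsPositive)
    (h : ∀ x, ⟪X x, x⟫ ≤ ‖x‖ ^ 2) : ‖X‖ ≤ 1 := by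
  rw [ContinuousLinearMap.norm_eq_iSup_rayleighQuotient X hX.isSymmetric]
  refine ciSup_le fun x => ?_
  have h0 : 0 ≤ ⟪X x, x⟫ := hX.inner_nonneg_left x
  rw [ContinuousLinearMap.rayleighQuotient, ContinuousLinearMap.reApplyInnerSelf_apply]
  simp only [RCLike.re_to_real]
  rw [abs_of_nonneg (by positivity)]
  exact div_le_one_of_le₀ (h x) (by positivity)

variable [CompleteSpace H]

/-- The series `U = ∑ Cₙ Xⁿ / 4ⁿ` over the Catalan numbers satisfies `U = 1 + X U² / 4`, hence
`1 - X U / 2` is a square root of `1 - X`. It is positive because `‖U‖ ≤ 2`. This takes the place of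
the continuous functional calculus, available for operators on complex Hilbert spaces only. -/
lemma exists_sqrt_one_sub {X : H →L[ℝ] H} (hX : X.IsPositive) (hX1 : ‖X‖ ≤ 1) :
    ∃ R : H →L[ℝ] H, R.IsPositive ∧ R ∘L R = 1 - X := by
  set b : ℕ → ℝ := fun n => (catalan n : ℝ) / 4 ^ n with hb
  have hb0 : ∀ n, 0 ≤ b n := fun n => by positivity
  have hbs : Summable b := summable_of_sum_range_le hb0 sum_range_catalan_div_le
  have hpow : ∀ n, ‖X ^ n‖ ≤ 1 := by
    intro n
    induction n with
    | zero => exact ContinuousLinearMap.norm_id_le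
    | succ n ih =>
      rw [pow_succ]
      exact (norm_mul_le _ _).trans (mul_le_one₀ ih (norm_nonneg _) hX1)
  have hle : ∀ n, ‖b n • X ^ n‖ ≤ b n := fun n => by
    rw [norm_smul, Real.norm_of_nonneg (hb0 n)]
    exact mul_le_of_le_one_right (hb0 n) (hpow n)
  have hsn : Summable fun n => ‖b n • X ^ n‖ :=
    Summable.of_nonneg_of_le (fun _ => norm_nonneg _) hle hbs
  have hs : Summable fun n => b n • X ^ n := hsn.of_norm
  set U : H →L[ℝ] H := ∑' n, b n • X ^ n with hU
  have hUn : ‖U‖ ≤ 2 :=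
    (norm_tsum_le_tsum_norm hsn).trans ((hsn.tsum_le_tsum hle hbs).trans
      (Real.tsum_le_of_sum_range_le hb0 sum_range_catalan_div_le))
  have hUsym : IsSelfAdjoint U := by
    rw [isSelfAdjoint_iff, hU, tsum_star]
    refine tsum_congr fun n => ?_
    simp [star_smul, hX.isSelfAdjoint.star_eq]
  have hcomm : Commute X U := by
    rw [hU]
    exact Commute.tsum_right _ fun n => ((Commute.refl X).pow_right n).smul_right _
  have hrec : U = 1 + (1 / 4 : ℝ) • (X * (U * U)) := by
    conv_lhs => rw [hU, hs.tsum_eq_zero_add]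
    rw [hU, tsum_mul_tsum_eq_tsum_sum_antidiagonal_of_summable_norm hsn hsn]
    have hs2 := summable_norm_sum_mul_antidiagonal_of_summable_norm hsn hsn |>.of_norm
    rw [← hs2.tsum_mul_left, ← (hs2.mul_left X).tsum_const_smul]
    congr 1
    · simp [hb]
    · refine tsum_congr fun n => ?_
      have : b (n + 1) =
          (1 / 4) * ∑ p ∈ Finset.HasAntidiagonal.antidiagonal n, b p.1 * b p.2 :=
        catalan_succ_div_four_pow n
      rw [this, mul_smul, Finset.sum_smul, Finset.mul_sum]
      congr 1
      refine Finset.sum_congr rfl fun p hp => ?_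
      rw [smul_mul_smul_comm, ← pow_add, Finset.HasAntidiagonal.mem_antidiagonal.1 hp,
        mul_smul_comm, ← pow_succ']
  have hXU : IsSelfAdjoint (X * U) := (hX.isSelfAdjoint.commute_iff hUsym).1 hcomm
  refine ⟨1 - (1 / 2 : ℝ) • (X * U), ?_, ?_⟩
  · rw [ContinuousLinearMap.isPositive_def']
    refine ⟨(IsSelfAdjoint.one _).sub
      (IsSelfAdjoint.smul (by simp [isSelfAdjoint_iff]) hXU), fun x => ?_⟩
    have h1 : ⟪(X * U) x, x⟫ ≤ 2 * ‖x‖ ^ 2 := by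
      refine (real_inner_le_norm _ _).trans ?_
      have h2 : ‖(X * U) x‖ ≤ 2 * ‖x‖ := by
        refine ((X * U).le_opNorm x).trans ?_
        gcongr
        refine (norm_mul_le _ _).trans ?_
        nlinarith [norm_nonneg X, norm_nonneg U]
      nlinarith [norm_nonneg x]
    rw [ContinuousLinearMap.reApplyInnerSelf_apply]
    simp only [sub_apply, smul_apply, inner_sub_left,
      real_inner_smul_left, one_apply_eq_self, RCLike.re_to_real,
      real_inner_self_eq_norm_sq]
    linarith
  · change (1 - (1 / 2 : ℝ) • (X * U)) * (1 - (1 / 2 : ℝ) • (X * U)) = 1 - X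
    have h3 : (X * U) * (X * U) = (4 : ℝ) • (X * U - X) := by
      have : X * (U * U) = (4 : ℝ) • (U - 1) := by
        conv_rhs => rw [hrec]
        simp [smul_smul]
      calc X * U * (X * U) = X * (X * (U * U)) := by
            rw [mul_assoc, ← mul_assoc U, ← hcomm.eq, mul_assoc]
        _ = (4 : ℝ) • (X * U - X) := by rw [this, mul_smul_comm, mul_sub, mul_one]
    simp only [sub_mul, mul_sub, one_mul, mul_one, smul_mul_smul_comm, h3, smul_smul]
    norm_num
    module

/-- The operator `1 - B / ‖B‖` is a positive contraction, so that `exists_sqrt_one_sub` applies. -/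
lemma exists_sqrt_of_isPositive {B : H →L[ℝ] H} (hB : B.IsPositive) :
    ∃ R : H →L[ℝ] H, R.IsPositive ∧ R ∘L R = B := by
  rcases eq_or_ne B 0 with rfl | hB0
  · exact ⟨0, ContinuousLinearMap.isPositive_zero, by simp⟩
  have hc : 0 < ‖B‖ := norm_pos_iff.2 hB0
  set X : H →L[ℝ] H := 1 - ‖B‖⁻¹ • B with hXdef
  have hX : X.IsPositive := by
    rw [ContinuousLinearMap.isPositive_def']
    refine ⟨(IsSelfAdjoint.one _).sub
      (IsSelfAdjoint.smul (by simp [isSelfAdjoint_iff]) hB.isSelfAdjoint), fun x => ?_⟩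
    have h1 : ⟪B x, x⟫ ≤ ‖B‖ * ‖x‖ ^ 2 := by
      refine (real_inner_le_norm _ _).trans ?_
      nlinarith [B.le_opNorm x, norm_nonneg x]
    rw [ContinuousLinearMap.reApplyInnerSelf_apply]
    simp only [hXdef, sub_apply, smul_apply, inner_sub_left,
      real_inner_smul_left, one_apply_eq_self, RCLike.re_to_real,
      real_inner_self_eq_norm_sq]
    rw [sub_nonneg, inv_mul_le_iff₀ hc]
    exact h1
  have hX1 : ‖X‖ ≤ 1 := by
    refine norm_le_one_of_inner_le hX fun x => ?_
    have h0 : 0 ≤ ⟪B x, x⟫ := hB.inner_nonneg_left x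
    simp only [hXdef, sub_apply, smul_apply, inner_sub_left,
      real_inner_smul_left, one_apply_eq_self, real_inner_self_eq_norm_sq]
    have : 0 ≤ ‖B‖⁻¹ * ⟪B x, x⟫ := by positivity
    linarith
  obtain ⟨R, hR, hRR⟩ := exists_sqrt_one_sub hX hX1
  refine ⟨√‖B‖ • R, hR.smul_of_nonneg (by positivity), ?_⟩
  rw [ContinuousLinearMap.smul_comp, ContinuousLinearMap.comp_smul, hRR, smul_smul,
    Real.mul_self_sqrt hc.le, hXdef, sub_sub_cancel, smul_smul, mul_inv_cancel₀ hc.ne', one_smul]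

lemma posSqrt_spec {B : H →L[ℝ] H} (hB : B.IsPositive) :
    (posSqrt B).IsPositive ∧ posSqrt B ∘L posSqrt B = B := by
  have h := exists_sqrt_of_isPositive hB
  rw [posSqrt, dif_pos h]
  exact h.choose_spec

/-! ### Covariance operators -/

lemma covOp_isPositive {S : ℝ → H →L[ℝ] H} {Q : H →L[ℝ] H} (hQ : Q.IsPositive) {t : ℝ}
    (ht : 0 ≤ t) : (covOp S Q t).IsPositive := by
  have hpos : ∀ s, (covIntegrand S Q s).IsPositive := fun s => hQ.conj_adjoint (S s)
  unfold covOp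
  by_cases hint : IntervalIntegrable (covIntegrand S Q) volume 0 t
  · have happ : ∀ x y : H, ⟪(∫ s in (0 : ℝ)..t, covIntegrand S Q s) x, y⟫
        = ∫ s in (0 : ℝ)..t, ⟪covIntegrand S Q s x, y⟫ := by
      intro x y
      have := ((innerSL ℝ y).comp (ContinuousLinearMap.apply ℝ H x)).intervalIntegral_comp_comm hint
      simpa [real_inner_comm] using this.symm
    refine ⟨fun x y => ?_, fun x => ?_⟩
    · rw [ContinuousLinearMap.coe_coe, happ, real_inner_comm, happ]
      refine intervalIntegral.integral_congr fun s _ => ?_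
      exact ((hpos s).isSymmetric x y).trans (real_inner_comm _ _)
    · change 0 ≤ ⟪_, _⟫
      rw [happ]
      exact intervalIntegral.integral_nonneg ht fun s _ => (hpos s).inner_nonneg_left x
  -- A non-integrable integrand would give the integral the value `0`, which is positive too.
  · rw [intervalIntegral.integral_undef hint]
    exact ContinuousLinearMap.isPositive_zero

end Operators

section WhiteNoise

/-! ### The isonormal Gaussian process -/

lemma integral_norm_le_norm_Lp_two {Ω E : Type*} {mΩ : MeasurableSpace Ω} {P : Measure Ω}
    [IsProbabilityMeasure P] [NormedAddCommGroup E] (f : Lp E 2 P) : ∫ ω, ‖f ω‖ ∂P ≤ ‖f‖ := by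
  rw [integral_norm_eq_lintegral_enorm (Lp.aestronglyMeasurable f), Lp.norm_def,
    ← eLpNorm_one_eq_lintegral_enorm]
  exact ENNReal.toReal_mono (Lp.eLpNorm_ne_top f)
    (eLpNorm_le_eLpNorm_of_exponent_le (by norm_num) (Lp.aestronglyMeasurable f))

variable {H : Type*} [NormedAddCommGroup H] [InnerProductSpace ℝ H]

/-- An isonormal Gaussian process (white noise) indexed by the Hilbert space `H`: a linear isometry
`W` from `H` to `L²(P)` such that each `W z` is a centred Gaussian variable, of variance `‖z‖²`
necessarily. -/
def IsIsonormal {Ω : Type*} {mΩ : MeasurableSpace Ω} (P : Measure Ω) (W : H →ₗᵢ[ℝ] Lp ℝ 2 P) :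
    Prop :=
  ∀ z : H, P.map (W z) = gaussianReal 0 (‖z‖₊ ^ 2)

section Construction

variable (ι : Type*)

/-- The law of a family of independent standard Gaussian variables. -/
noncomputable def stdGaussianPi : Measure (ι → ℝ) := Measure.infinitePi fun _ => gaussianReal 0 1

instance : IsProbabilityMeasure (stdGaussianPi ι) := by
  unfold stdGaussianPi; infer_instance

variable {ι}

lemma memLp_eval_stdGaussianPi (i : ι) : MemLp (fun ω : ι → ℝ => ω i) 2 (stdGaussianPi ι) := by
  have h := measurePreserving_eval_infinitePi (fun _ : ι => gaussianReal 0 1) i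
  exact (memLp_id_gaussianReal 2).comp_measurePreserving h

/-- The `i`-th coordinate, as an element of `L²`. -/
noncomputable def coordLp (i : ι) : Lp ℝ 2 (stdGaussianPi ι) := (memLp_eval_stdGaussianPi i).toLp _

lemma hasLaw_eval_stdGaussianPi (i : ι) :
    HasLaw (fun ω : ι → ℝ => ω i) (gaussianReal 0 1) (stdGaussianPi ι) :=
  (measurePreserving_eval_infinitePi (fun _ : ι => gaussianReal 0 1) i).hasLaw

lemma orthonormal_coordLp : Orthonormal ℝ (coordLp (ι := ι)) := by
  classical
  have hinner : ∀ i j : ι, ⟪coordLp i, coordLp j⟫ = ∫ ω : ι → ℝ, ω i * ω j ∂stdGaussianPi ι := by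
    intro i j
    rw [L2.inner_def]
    refine integral_congr_ae ?_
    filter_upwards [(memLp_eval_stdGaussianPi i).coeFn_toLp,
      (memLp_eval_stdGaussianPi j).coeFn_toLp] with ω hi hj
    simp only [coordLp]
    rw [hi, hj]
    simp [mul_comm]
  have hmean : ∀ i : ι, ∫ ω : ι → ℝ, ω i ∂stdGaussianPi ι = 0 := fun i => by
    rw [(hasLaw_eval_stdGaussianPi i).integral_eq, integral_id_gaussianReal]
  rw [orthonormal_iff_ite]
  intro i j
  rw [hinner]
  split_ifs with hij
  · subst hij
    have h := (hasLaw_eval_stdGaussianPi i).variance_eq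
    rw [variance_id_gaussianReal, variance_eq_integral (measurable_pi_apply i).aemeasurable, hmean]
      at h
    simpa [sq] using h
  · have hind : IndepFun (fun ω : ι → ℝ => ω i) (fun ω => ω j) (stdGaussianPi ι) :=
      (iIndepFun_infinitePi (P := fun _ : ι => gaussianReal 0 1) (X := fun _ x => x)
        (fun _ => measurable_id)).indepFun hij
    rw [hind.integral_fun_mul_eq_mul_integral (measurable_pi_apply i).aestronglyMeasurable
      (measurable_pi_apply j).aestronglyMeasurable, hmean, zero_mul]

/-- The characteristic function at `1` of the law of `f` is Lipschitz in `f` for the `L²` norm. This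
carries Gaussian laws over to `L²` limits. -/
lemma norm_integral_exp_sub_le {Ω : Type*} {mΩ : MeasurableSpace Ω} {P : Measure Ω}
    [IsProbabilityMeasure P] (f g : Lp ℝ 2 P) :
    ‖(∫ ω, Complex.exp (f ω * Complex.I) ∂P) - ∫ ω, Complex.exp (g ω * Complex.I) ∂P‖
      ≤ ‖f - g‖ := by
  have hint : ∀ f : Lp ℝ 2 P, Integrable (fun ω => Complex.exp (f ω * Complex.I)) P := fun f => by
    refine Integrable.of_bound (C := 1) ?_ (by simp [Complex.norm_exp_ofReal_mul_I])
    exact (Complex.measurable_exp.comp_aemeasurable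
      ((Complex.measurable_ofReal.comp_aemeasurable
        (Lp.aestronglyMeasurable f).aemeasurable).mul_const _)).aestronglyMeasurable
  rw [← integral_sub (hint f) (hint g)]
  refine (norm_integral_le_integral_norm _).trans ((integral_mono_ae ?_ ?_ ?_).trans
    (integral_norm_le_norm_Lp_two (f - g)))
  · exact ((hint f).sub (hint g)).norm
  · exact ((Lp.memLp (f - g)).integrable (by norm_num)).norm
  · filter_upwards [Lp.coeFn_sub f g] with ω h
    rw [h]
    have : Complex.exp (f ω * Complex.I) - Complex.exp (g ω * Complex.I) =
        Complex.exp (g ω * Complex.I) *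
          (Complex.exp (Complex.I * ((f ω - g ω : ℝ) : ℂ)) - 1) := by
      rw [mul_sub, ← Complex.exp_add, mul_one]
      congr 2
      push_cast
      ring
    simp only [this, norm_mul, Complex.norm_exp_ofReal_mul_I, one_mul, Pi.sub_apply]
    exact Real.norm_exp_I_mul_ofReal_sub_one_le

lemma integral_exp_sum_coordLp (s : Finset ι) (c : ι → ℝ) :
    ∫ ω, Complex.exp ((∑ i ∈ s, c i • coordLp i : Lp ℝ 2 (stdGaussianPi ι)) ω * Complex.I)
      ∂stdGaussianPi ι = Complex.exp (-((∑ i ∈ s, c i ^ 2 : ℝ) / 2 : ℂ)) := by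
  have hae : (∑ i ∈ s, c i • coordLp i : Lp ℝ 2 (stdGaussianPi ι)) =ᵐ[stdGaussianPi ι]
      fun ω => ∑ i ∈ s, c i * ω i := by
    have h1 : ∀ᵐ ω ∂stdGaussianPi ι, ∀ i ∈ s, (c i • coordLp i : Lp ℝ 2 (stdGaussianPi ι)) ω
        = c i * ω i := by
      refine (Filter.eventually_all_finset s).2 fun i _ => ?_
      filter_upwards [Lp.coeFn_smul (c i) (coordLp i),
        (memLp_eval_stdGaussianPi i).coeFn_toLp] with ω h2 h3
      rw [h2, Pi.smul_apply, coordLp, h3, smul_eq_mul]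
    filter_upwards [Lp.coeFn_finsetSum s fun i => c i • coordLp (ι := ι) i, h1] with ω h2 h3
    rw [h2, Finset.sum_apply]
    exact Finset.sum_congr rfl h3
  have hind : iIndepFun (fun i (ω : ι → ℝ) => c i * ω i) (stdGaussianPi ι) :=
    iIndepFun_infinitePi (P := fun _ : ι => gaussianReal 0 1) (X := fun i x => c i * x)
        (fun i => measurable_id.const_mul _)
  have hlaw : ∀ i, (stdGaussianPi ι).map (fun ω : ι → ℝ => c i * ω i) = _ := fun i =>
    (gaussianReal_const_mul (hasLaw_eval_stdGaussianPi i) (c i)).map_eq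
  have hm : ∀ i, Measurable fun ω : ι → ℝ => c i * ω i := fun i =>
    (measurable_pi_apply i).const_mul _
  have hchar := hind.restrict s |>.charFun_map_fun_finsetSum_eq_prod
    (fun i _ => (hm i).aemeasurable)
  have h1 := congrFun hchar 1
  rw [charFun_apply_real, integral_map
    (Finset.measurable_fun_sum s fun i _ => hm i).aemeasurable (by fun_prop)] at h1
  rw [integral_congr_ae
    (g := fun ω => Complex.exp ((1 : ℝ) * (∑ i ∈ s, c i * ω i : ℝ) * Complex.I)) ?_, h1]
  · rw [Finset.prod_apply]
    simp only [hlaw, charFun_gaussianReal]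
    rw [← Complex.exp_sum]
    simp [Finset.sum_div, Finset.sum_neg_distrib]
  · filter_upwards [hae] with ω h
    rw [h]; simp

/-- The isonormal process attached to a Hilbert basis `e`: `W z = ∑ᵢ ⟨e i, z⟩ ωᵢ`. -/
noncomputable def isonormalOfBasis (e : HilbertBasis ι ℝ H) :
    H →ₗᵢ[ℝ] Lp ℝ 2 (stdGaussianPi ι) :=
  (orthonormal_coordLp (ι := ι)).orthogonalFamily.linearIsometry.comp e.repr.toLinearIsometry

lemma hasSum_isonormalOfBasis (e : HilbertBasis ι ℝ H) (z : H) :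
    HasSum (fun i => ⟪e i, z⟫ • coordLp i) (isonormalOfBasis e z) := by
  have := (orthonormal_coordLp (ι := ι)).orthogonalFamily.hasSum_linearIsometry (e.repr z)
  simp only [e.repr_apply_apply, LinearIsometry.toSpanSingleton_apply] at this
  exact this

lemma integral_exp_isonormalOfBasis (e : HilbertBasis ι ℝ H) (z : H) :
    ∫ ω, Complex.exp (isonormalOfBasis e z ω * Complex.I) ∂stdGaussianPi ι
      = Complex.exp (-((‖z‖ ^ 2 : ℝ) / 2 : ℂ)) := by
  have h1 : Tendsto (fun s : Finset ι => ∫ ω, Complex.exp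
      ((∑ i ∈ s, ⟪e i, z⟫ • coordLp i : Lp ℝ 2 (stdGaussianPi ι)) ω * Complex.I) ∂stdGaussianPi ι)
      atTop (𝓝 (∫ ω, Complex.exp (isonormalOfBasis e z ω * Complex.I) ∂stdGaussianPi ι)) := by
    rw [tendsto_iff_norm_sub_tendsto_zero]
    exact squeeze_zero (fun _ => norm_nonneg _) (fun s => norm_integral_exp_sub_le _ _)
      (tendsto_iff_norm_sub_tendsto_zero.1 (hasSum_isonormalOfBasis e z))
  simp only [integral_exp_sum_coordLp] at h1
  refine tendsto_nhds_unique h1 ?_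
  have h2 : HasSum (fun i => ⟪e i, z⟫ ^ 2) (‖z‖ ^ 2) := by
    have := e.hasSum_inner_mul_inner z z
    simpa [real_inner_self_eq_norm_sq, real_inner_comm, sq] using this
  have hc : Continuous fun r : ℝ => Complex.exp (-((r : ℂ) / 2)) := by fun_prop
  exact (hc.tendsto _).comp h2

lemma isIsonormal_isonormalOfBasis (e : HilbertBasis ι ℝ H) :
    IsIsonormal (stdGaussianPi ι) (isonormalOfBasis e) := by
  intro z
  have hm : AEMeasurable (isonormalOfBasis e z) (stdGaussianPi ι) :=
    (Lp.aestronglyMeasurable _).aemeasurable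
  have := Measure.isProbabilityMeasure_map hm
  refine Measure.ext_of_charFun (funext fun t => ?_)
  rw [charFun_gaussianReal, charFun_apply_real, integral_map hm (by fun_prop)]
  have h := integral_exp_isonormalOfBasis e (t • z)
  rw [integral_congr_ae (g := fun ω => Complex.exp (t * isonormalOfBasis e z ω * Complex.I))] at h
  · rw [h, norm_smul]
    congr 1
    simp only [mul_pow, Real.norm_eq_abs, sq_abs]
    simp
    ring
  · rw [map_smul]
    filter_upwards [Lp.coeFn_smul t (isonormalOfBasis e z)] with ω hω
    rw [hω]; simp

end Construction

end WhiteNoise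

/-! ### Exponential moments of the isonormal process -/

section Isonormal

variable {H : Type*} [NormedAddCommGroup H] [InnerProductSpace ℝ H]
  {Ω : Type*} {mΩ : MeasurableSpace Ω} {P : Measure Ω} {W : H →ₗᵢ[ℝ] Lp ℝ 2 P}

lemma aemeasurable_Lp (f : Lp ℝ 2 P) : AEMeasurable f P := (Lp.aestronglyMeasurable f).aemeasurable

lemma map_linearComb_ae (W : H →ₗᵢ[ℝ] Lp ℝ 2 P) (a b : ℝ) (u v : H) :
    W (a • u + b • v) =ᵐ[P] fun ω => a * W u ω + b * W v ω := by
  rw [map_add, map_smul, map_smul]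
  filter_upwards [Lp.coeFn_add (a • W u) (b • W v), Lp.coeFn_smul a (W u),
    Lp.coeFn_smul b (W v)] with ω h1 h2 h3
  rw [h1, Pi.add_apply, h2, h3]
  rfl

lemma IsIsonormal.integral_cexp (hW : IsIsonormal P W) (z : H) (c : ℂ) :
    ∫ ω, Complex.exp (c * W z ω) ∂P = Complex.exp ((‖z‖ : ℂ) ^ 2 * c ^ 2 / 2) := by
  have := complexMGF_gaussianReal (hW z) c
  rw [complexMGF] at this
  rw [this]
  simp

lemma IsIsonormal.indepFun (hW : IsIsonormal P W) [IsProbabilityMeasure P] {u v : H}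
    (huv : ⟪u, v⟫ = 0) : IndepFun (W u) (W v) P := by
  have hu := aemeasurable_Lp (W u)
  have hv := aemeasurable_Lp (W v)
  rw [indepFun_iff_charFun_prod hu hv]
  intro t
  have hchar : ∀ (z : H) (s : ℝ), charFun (P.map (W z)) s =
      Complex.exp (-((‖z‖ ^ 2 * s ^ 2 / 2 : ℝ) : ℂ)) := by
    intro z s
    rw [hW z, charFun_gaussianReal]
    simp
  rw [hchar, hchar, ← Complex.exp_add, charFun_apply, integral_map (by fun_prop) (by fun_prop)]
  have h := hW.integral_cexp (t.ofLp.1 • u + t.ofLp.2 • v) Complex.I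
  rw [integral_congr_ae (g := fun ω => Complex.exp
    ((⟪WithLp.toLp 2 (W u ω, W v ω), t⟫ : ℝ) * Complex.I))] at h
  · rw [h]
    congr 1
    have hn : ‖t.ofLp.1 • u + t.ofLp.2 • v‖ ^ 2 =
        ‖u‖ ^ 2 * t.ofLp.1 ^ 2 + ‖v‖ ^ 2 * t.ofLp.2 ^ 2 := by
      rw [norm_add_sq_real, norm_smul, norm_smul, real_inner_smul_left, real_inner_smul_right, huv]
      simp only [mul_pow, Real.norm_eq_abs, sq_abs]
      ring
    have hn' : (‖t.ofLp.1 • u + t.ofLp.2 • v‖ : ℂ) ^ 2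
        = ((‖u‖ ^ 2 * t.ofLp.1 ^ 2 + ‖v‖ ^ 2 * t.ofLp.2 ^ 2 : ℝ) : ℂ) := by
      rw [← hn]; push_cast; ring
    rw [hn', Complex.I_sq]
    push_cast
    ring
  · filter_upwards [map_linearComb_ae W t.ofLp.1 t.ofLp.2 u v] with ω hω
    rw [hω, WithLp.prod_inner_apply, mul_comm]
    simp [mul_comm]

/-- The joint exponential transform of two variables of the isonormal process. It is obtained by
splitting `u` into a multiple of `w` and a vector orthogonal to `w`, on which `W` takes independent
values. -/
lemma IsIsonormal.integral_exp_add (hW : IsIsonormal P W) [IsProbabilityMeasure P] (u w : H) :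
    ∫ ω, Complex.exp (W w ω + W u ω * Complex.I) ∂P =
      Complex.exp ((‖w‖ ^ 2 / 2 - ‖u‖ ^ 2 / 2 : ℝ) + (⟪u, w⟫ : ℝ) * Complex.I) := by
  -- For `w = 0` the quotient is zero, as it should be.
  set a : ℝ := ⟪u, w⟫ / ‖w‖ ^ 2 with ha
  set v : H := u - a • w with hv
  have haw : a * ‖w‖ ^ 2 = ⟪u, w⟫ := by
    rcases eq_or_ne w 0 with rfl | hw
    · simp
    · rw [ha, div_mul_cancel₀]
      simpa using hw
  have hvw : ⟪w, v⟫ = 0 := by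
    rw [hv, inner_sub_right, real_inner_smul_right, real_inner_self_eq_norm_sq, haw,
      real_inner_comm, sub_self]
  have hu : u = a • w + (1 : ℝ) • v := by rw [hv, one_smul]; abel
  have hnorm : ‖u‖ ^ 2 = a ^ 2 * ‖w‖ ^ 2 + ‖v‖ ^ 2 := by
    rw [hu, norm_add_sq_real, one_smul, real_inner_smul_left, hvw, norm_smul, Real.norm_eq_abs,
      mul_pow, sq_abs]
    ring
  have hint := (hW.indepFun hvw).integral_fun_comp_mul_comp (𝕜 := ℂ)
    (f := fun x : ℝ => Complex.exp ((1 + a * Complex.I) * x))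
    (g := fun x : ℝ => Complex.exp (Complex.I * x)) (aemeasurable_Lp _) (aemeasurable_Lp _)
    (by fun_prop) (by fun_prop)
  rw [hW.integral_cexp, hW.integral_cexp, ← Complex.exp_add] at hint
  rw [integral_congr_ae (g := fun ω => Complex.exp ((1 + a * Complex.I) * W w ω) *
    Complex.exp (Complex.I * W v ω)), hint]
  · rw [← haw, hnorm]
    congr 1
    push_cast
    linear_combination ((a : ℂ) ^ 2 * ‖w‖ ^ 2 / 2 + (‖v‖ : ℂ) ^ 2 / 2) * Complex.I_sq
  · have hae := map_linearComb_ae W a 1 w v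
    rw [← hu] at hae
    filter_upwards [hae] with ω hω
    rw [hω, ← Complex.exp_add]
    congr 1
    push_cast
    ring

/-- The Cameron-Martin density `exp (W w - ‖w‖² / 2)`. -/
noncomputable def cmDensity (W : H →ₗᵢ[ℝ] Lp ℝ 2 P) (w : H) (ω : Ω) : ℝ :=
  Real.exp (W w ω - ‖w‖ ^ 2 / 2)

lemma aemeasurable_cmDensity (w : H) : AEMeasurable (cmDensity W w) P :=
  Real.measurable_exp.comp_aemeasurable ((aemeasurable_Lp (W w)).sub_const _)

lemma IsIsonormal.integrable_cmDensity (hW : IsIsonormal P W) (w : H) :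
    Integrable (cmDensity W w) P := by
  have h : Integrable (fun x : ℝ => Real.exp (1 * x)) (P.map (W w)) := by
    rw [hW w]; exact integrable_exp_mul_gaussianReal 1
  have h1 := (h.comp_aemeasurable (aemeasurable_Lp _)).const_mul (Real.exp (-(‖w‖ ^ 2 / 2)))
  refine h1.congr (ae_of_all _ fun ω => ?_)
  simp only [Function.comp_apply, one_mul, cmDensity]
  rw [← Real.exp_add]
  ring_nf

lemma abs_exp_sub_one_sub_le {r : ℝ} (hr0 : 0 ≤ r) (hr1 : r ≤ 1) (y : ℝ) :
    |Real.exp (r * y - r ^ 2 / 2) - 1 - r * y|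
      ≤ r ^ 2 * (2 * (Real.exp (2 * y) + Real.exp (-2 * y))) := by
  have h1 : ∀ s : ℝ, |Real.exp s - 1 - s| ≤ s ^ 2 * Real.exp |s| := fun s => by
    have h := Complex.norm_exp_sub_sum_le_norm_mul_exp (s : ℂ) 2
    simp only [Finset.sum_range_succ, Finset.sum_range_zero] at h
    norm_num at h
    rw [← Complex.ofReal_exp] at h
    have h' : ((Real.exp s : ℝ) : ℂ) - (1 + (s : ℂ)) = ((Real.exp s - 1 - s : ℝ) : ℂ) := by
      push_cast; ring
    rw [h', Complex.norm_real, Real.norm_eq_abs] at h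
    exact h
  have hle : |r * y| ≤ |y| := by
    rw [abs_mul, abs_of_nonneg hr0]
    exact mul_le_of_le_one_left (abs_nonneg _) hr1
  have hE : Real.exp |r * y| ≤ Real.exp |y| := Real.exp_le_exp.2 hle
  have h2 : |Real.exp (r * y - r ^ 2 / 2) - Real.exp (r * y)| ≤ r ^ 2 / 2 * Real.exp |y| := by
    rw [sub_eq_add_neg (r * y), Real.exp_add, ← mul_sub_one, abs_mul, Real.abs_exp, mul_comm]
    refine mul_le_mul ?_ ((Real.exp_le_exp.2 (le_abs_self _)).trans hE) (Real.exp_nonneg _)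
      (by positivity)
    have h3 : Real.exp (-(r ^ 2 / 2)) ≤ 1 := Real.exp_le_one_iff.2 (by nlinarith)
    rw [abs_of_nonpos (by linarith)]
    linarith [Real.add_one_le_exp (-(r ^ 2 / 2))]
  have h4 : |Real.exp (r * y - r ^ 2 / 2) - 1 - r * y| ≤
      r ^ 2 * ((y ^ 2 + 1 / 2) * Real.exp |y|) := by
    have h5 := h1 (r * y)
    have h6 : (r * y) ^ 2 * Real.exp |r * y| ≤ (r * y) ^ 2 * Real.exp |y| := by gcongr
    calc |Real.exp (r * y - r ^ 2 / 2) - 1 - r * y|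
        = |(Real.exp (r * y - r ^ 2 / 2) - Real.exp (r * y)) + (Real.exp (r * y) - 1 - r * y)| := by
          ring_nf
      _ ≤ _ := abs_add_le _ _
      _ ≤ r ^ 2 * ((y ^ 2 + 1 / 2) * Real.exp |y|) := by nlinarith
  have h7 : y ^ 2 + 1 / 2 ≤ 2 * Real.exp |y| := by
    have := Real.quadratic_le_exp_of_nonneg (abs_nonneg y)
    nlinarith [abs_nonneg y, sq_abs y]
  have h8 : Real.exp |y| * Real.exp |y| ≤ Real.exp (2 * y) + Real.exp (-2 * y) := by
    rw [← Real.exp_add]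
    rcases abs_cases y with ⟨h, _⟩ | ⟨h, _⟩ <;> rw [h]
    · rw [← two_mul]; linarith [Real.exp_nonneg (-2 * y)]
    · rw [show -y + -y = -2 * y by ring]; linarith [Real.exp_nonneg (2 * y)]
  refine h4.trans (mul_le_mul_of_nonneg_left ?_ (sq_nonneg r))
  nlinarith [Real.exp_pos |y|]

/-- Second order Taylor estimate in `L¹` for the Cameron-Martin density at `w = 0`. -/
lemma IsIsonormal.integral_abs_cmDensity_sub_le (hW : IsIsonormal P W) {w : H}
    (hw : ‖w‖ ≤ 1) :
    ∫ ω, |cmDensity W w ω - 1 - W w ω| ∂P ≤ 4 * Real.exp 2 * ‖w‖ ^ 2 := by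
  -- The law of `W w` is that of `‖w‖ y` with `y` standard Gaussian, which makes the bound scale.
  have hlaw : P.map (W w) = (gaussianReal 0 1).map (fun y => ‖w‖ * y) := by
    rw [hW w, gaussianReal_map_const_mul]
    congr 1
    · simp
    · ext; simp
  have h1 : ∫ ω, |cmDensity W w ω - 1 - W w ω| ∂P =
      ∫ y, |Real.exp (‖w‖ * y - ‖w‖ ^ 2 / 2) - 1 - ‖w‖ * y| ∂gaussianReal 0 1 := by
    have h := integral_map (μ := P) (φ := W w) (aemeasurable_Lp _)
      (f := fun x : ℝ => |Real.exp (x - ‖w‖ ^ 2 / 2) - 1 - x|) (by fun_prop)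
    rw [hlaw, integral_map (by fun_prop) (by fun_prop)] at h
    exact h.symm
  rw [h1]
  have hint : ∀ c : ℝ, Integrable (fun y : ℝ => Real.exp (c * y)) (gaussianReal 0 1) :=
    fun c => integrable_exp_mul_gaussianReal c
  have hval : ∀ c : ℝ, ∫ y, Real.exp (c * y) ∂gaussianReal 0 1 = Real.exp (c ^ 2 / 2) := fun c => by
    have := congrFun (mgf_fun_id_gaussianReal (μ := 0) (v := 1)) c
    simpa [mgf] using this
  have hg : Integrable (fun y : ℝ => ‖w‖ ^ 2 * (2 * (Real.exp (2 * y) + Real.exp (-2 * y))))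
      (gaussianReal 0 1) := (((hint 2).add (hint (-2))).const_mul 2).const_mul _
  refine (integral_mono_of_nonneg (ae_of_all _ fun _ => abs_nonneg _) hg
    (ae_of_all _ fun y => abs_exp_sub_one_sub_le (norm_nonneg w) hw y)).trans (le_of_eq ?_)
  rw [integral_const_mul, integral_const_mul, integral_add (hint 2) (hint (-2)), hval, hval]
  norm_num
  ring

end Isonormal

section Representation

variable {H : Type*} [NormedAddCommGroup H] [InnerProductSpace ℝ H]
  {Ω : Type*} {mΩ : MeasurableSpace Ω} {P : Measure Ω} {W : H →ₗᵢ[ℝ] Lp ℝ 2 P}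

/-! ### Gaussian vectors with a prescribed covariance -/

/-- `X` is a random vector with `⟨X, h⟩ = W (R h)` for every `h`, for an
isonormal process `W`; for a symmetric `R` its law is then the centred Gaussian measure of
covariance `R ∘ R`. -/
def IsImageOf (R : H →L[ℝ] H) (W : H →ₗᵢ[ℝ] Lp ℝ 2 P) (X : Ω → H) : Prop :=
  AEStronglyMeasurable X P ∧ ∀ h : H, (fun ω => ⟪X ω, h⟫) =ᵐ[P] W (R h)

/-- If `R` is Hilbert-Schmidt, the series `∑ᵢ W (e i) • R (e i)` converges in `L²(P; H)`. -/
lemma exists_isImageOf [CompleteSpace H] (W : H →ₗᵢ[ℝ] Lp ℝ 2 P) {ι : Type*}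
    (e : HilbertBasis ι ℝ H) {R : H →L[ℝ] H} (hR : R.IsPositive)
    (hHS : Summable fun i => ‖R (e i)‖ ^ 2) : ∃ X : Ω → H, IsImageOf R W X := by
  classical
  set V : ι → Lp H 2 P := fun i =>
    (ContinuousLinearMap.toSpanSingleton ℝ (R (e i))).compLpL 2 P (W (e i)) with hV
  have hVae : ∀ i, V i =ᵐ[P] fun ω => W (e i) ω • R (e i) := fun i => by
    filter_upwards [(ContinuousLinearMap.toSpanSingleton ℝ (R (e i))).coeFn_compLpL (p := 2)
      (W (e i))] with ω h
    rw [hV, h, ContinuousLinearMap.toSpanSingleton_apply]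
  have hinner : ∀ i j, ⟪V i, V j⟫ = if i = j then ‖R (e i)‖ ^ 2 else 0 := by
    intro i j
    have h1 : ⟪V i, V j⟫ = ⟪W (e i), W (e j)⟫ * ⟪R (e i), R (e j)⟫ := by
      rw [L2.inner_def, L2.inner_def, ← integral_mul_const]
      refine integral_congr_ae ?_
      filter_upwards [hVae i, hVae j] with ω hi hj
      rw [hi, hj, real_inner_smul_left, real_inner_smul_right]
      simp
      ring
    rw [h1, W.inner_map_map, orthonormal_iff_ite.1 e.orthonormal]
    split_ifs with h
    · subst h; rw [one_mul, real_inner_self_eq_norm_sq]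
    · rw [zero_mul]
  have hsum : Summable V := by
    rw [summable_iff_vanishing_norm]
    intro ε hε
    obtain ⟨s, hs⟩ := summable_iff_vanishing_norm.1 hHS (ε ^ 2) (by positivity)
    refine ⟨s, fun t ht => ?_⟩
    have h2 : ‖∑ i ∈ t, V i‖ ^ 2 = ∑ i ∈ t, ‖R (e i)‖ ^ 2 := by
      rw [← real_inner_self_eq_norm_sq, sum_inner]
      refine Finset.sum_congr rfl fun i hi => ?_
      rw [inner_sum]
      simp [hinner, hi]
    have h3 := hs t ht
    rw [Real.norm_of_nonneg (Finset.sum_nonneg fun _ _ => sq_nonneg _), ← h2] at h3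
    exact lt_of_pow_lt_pow_left₀ 2 hε.le h3
  refine ⟨(∑' i, V i : Lp H 2 P), Lp.aestronglyMeasurable _, fun h => ?_⟩
  have h4 := ((innerSL ℝ h).compLpL 2 P).hasSum hsum.hasSum
  have h5 : ∀ i, (innerSL ℝ h).compLpL 2 P (V i) = ⟪e i, R h⟫ • W (e i) := by
    intro i
    refine Lp.ext ?_
    filter_upwards [(innerSL ℝ h).coeFn_compLpL (p := 2) (V i), hVae i,
      Lp.coeFn_smul ⟪e i, R h⟫ (W (e i))] with ω h6 h7 h8
    rw [h6, h7, h8, innerSL_apply_apply, real_inner_smul_right, Pi.smul_apply, smul_eq_mul,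
      mul_comm]
    congr 1
    rw [real_inner_comm]
    exact hR.isSymmetric (e i) h
  have h9 := W.toContinuousLinearMap.hasSum (e.hasSum_repr (R h))
  simp only [h5] at h4
  have h10 : (innerSL ℝ h).compLpL 2 P (∑' i, V i) = W (R h) := by
    refine h4.unique ?_
    simpa [Function.comp_def, e.repr_apply_apply] using h9
  rw [← h10]
  filter_upwards [(innerSL ℝ h).coeFn_compLpL (p := 2) (∑' i, V i)] with ω h11
  rw [h11, innerSL_apply_apply, real_inner_comm]

lemma norm_sq_eq_inner_comp {R : H →L[ℝ] H} (hR : R.IsPositive) (h : H) :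
    ‖R h‖ ^ 2 = ⟪(R ∘L R) h, h⟫ := by
  rw [← real_inner_self_eq_norm_sq]
  exact (hR.isSymmetric (R h) h).symm

variable [MeasurableSpace H] [BorelSpace H]

variable {R : H →L[ℝ] H} {X : Ω → H}

lemma IsIsonormal.isGaussianWith_map_add [CompleteSpace H] [SecondCountableTopology H]
    [IsProbabilityMeasure P] (hW : IsIsonormal P W)
    (hR : R.IsPositive) (hX : IsImageOf R W X) (m : H) :
    IsGaussianWith m (R ∘L R) (P.map fun ω => X ω + m) := by
  have hXm : AEMeasurable (fun ω => X ω + m) P := hX.1.aemeasurable.add_const m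
  refine ⟨Measure.isProbabilityMeasure_map hXm, fun h => ?_⟩
  rw [charFun_apply, integral_map hXm (by fun_prop)]
  rw [integral_congr_ae (g := fun ω => Complex.exp ((⟪m, h⟫ : ℝ) * Complex.I) *
    Complex.exp (Complex.I * W (R h) ω)), integral_const_mul, hW.integral_cexp,
    ← Complex.exp_add]
  · rw [← norm_sq_eq_inner_comp hR, Complex.I_sq]
    congr 1
    push_cast
    ring
  · filter_upwards [hX.2 h] with ω hω
    rw [← hω, ← Complex.exp_add, inner_add_left]
    congr 1
    push_cast
    ring

lemma gaussian_eq_map_add [CompleteSpace H] [TopologicalSpace.SeparableSpace H]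
    [IsProbabilityMeasure P] (hW : IsIsonormal P W)
    (hR : R.IsPositive) (hX : IsImageOf R W X) (m : H) :
    gaussian m (R ∘L R) = P.map fun ω => X ω + m := by
  have : SecondCountableTopology H := UniformSpace.secondCountable_of_separable H
  have h : ∃ μ : Measure H, IsGaussianWith m (R ∘L R) μ :=
    ⟨_, hW.isGaussianWith_map_add hR hX m⟩
  rw [gaussian, dif_pos h]
  exact h.choose_spec.unique (hW.isGaussianWith_map_add hR hX m)

/-! ### The Cameron-Martin formula -/

/-- Cameron-Martin: a translation of `X` by `R w` amounts to the change of measure of density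
`cmDensity W w`. -/
lemma IsIsonormal.map_add_eq_map_withDensity [CompleteSpace H] [SecondCountableTopology H]
    [IsProbabilityMeasure P]
    (hW : IsIsonormal P W) (hR : R.IsPositive) (hX : IsImageOf R W X) (w : H) :
    P.map (fun ω => X ω + R w) =
      (P.withDensity fun ω => ENNReal.ofReal (cmDensity W w ω)).map X := by
  have hXw : AEMeasurable (fun ω => X ω + R w) P := hX.1.aemeasurable.add_const _
  have hac : (P.withDensity fun ω => ENNReal.ofReal (cmDensity W w ω)) ≪ P :=
    withDensity_absolutelyContinuous _ _
  have hfin : IsFiniteMeasure (P.withDensity fun ω => ENNReal.ofReal (cmDensity W w ω)) :=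
    isFiniteMeasure_withDensity_ofReal (hW.integrable_cmDensity w).2
  have hXd : AEMeasurable X (P.withDensity fun ω => ENNReal.ofReal (cmDensity W w ω)) :=
    hX.1.aemeasurable.mono_ac hac
  refine Measure.ext_of_charFun (funext fun h => ?_)
  rw [(hW.isGaussianWith_map_add hR hX (R w)).2 h, charFun_apply, integral_map hXd (by fun_prop),
    integral_withDensity_eq_integral_toReal_smul₀ (aemeasurable_cmDensity w).ennreal_ofReal
      (ae_of_all _ fun _ => ENNReal.ofReal_lt_top)]
  have h1 := hW.integral_exp_add (R h) w
  rw [integral_congr_ae (g := fun ω => Complex.exp ((-(‖w‖ ^ 2 / 2) : ℝ) : ℂ) *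
    Complex.exp (W w ω + W (R h) ω * Complex.I)), integral_const_mul, h1, ← Complex.exp_add,
    ← norm_sq_eq_inner_comp hR]
  · congr 1
    have h2 : ⟪R w, h⟫ = ⟪R h, w⟫ := by rw [real_inner_comm w]; exact hR.isSymmetric w h
    rw [h2]
    push_cast
    ring
  · filter_upwards [hX.2 h] with ω hω
    have hd : 0 ≤ cmDensity W w ω := Real.exp_nonneg _
    rw [← hω, ENNReal.toReal_ofReal hd, cmDensity, Complex.real_smul, Complex.ofReal_exp,
      ← Complex.exp_add, ← Complex.exp_add]
    congr 1
    push_cast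
    ring

lemma IsIsonormal.integral_comp_add [CompleteSpace H] [SecondCountableTopology H]
    [IsProbabilityMeasure P]
    (hW : IsIsonormal P W) (hR : R.IsPositive) (hX : IsImageOf R W X) (w : H) {g : H → ℝ}
    (hg : Measurable g) :
    ∫ ω, g (X ω + R w) ∂P = ∫ ω, cmDensity W w ω * g (X ω) ∂P := by
  have hXw : AEMeasurable (fun ω => X ω + R w) P := hX.1.aemeasurable.add_const _
  have hXd : AEMeasurable X (P.withDensity fun ω => ENNReal.ofReal (cmDensity W w ω)) :=
    hX.1.aemeasurable.mono_ac (withDensity_absolutelyContinuous _ _)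
  rw [← integral_map hXw hg.aestronglyMeasurable, hW.map_add_eq_map_withDensity hR hX w,
    integral_map hXd hg.aestronglyMeasurable,
    integral_withDensity_eq_integral_toReal_smul₀ (aemeasurable_cmDensity w).ennreal_ofReal
      (ae_of_all _ fun _ => ENNReal.ofReal_lt_top)]
  refine integral_congr_ae (ae_of_all _ fun ω => ?_)
  simp only [cmDensity, smul_eq_mul]
  rw [ENNReal.toReal_ofReal (Real.exp_nonneg _)]

/-! ### Smoothing along the range of `R` -/

variable {g : H → ℝ} {M : ℝ}

lemma memLp_comp_add [SecondCountableTopology H] [IsProbabilityMeasure P]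
    (hX : IsImageOf R W X) (hg : Measurable g) (hM : ∀ y, |g y| ≤ M) (m : H) :
    MemLp (fun ω => g (X ω + m)) 2 P :=
  MemLp.of_bound (hg.comp_aemeasurable (hX.1.aemeasurable.add_const m)).aestronglyMeasurable M
    (ae_of_all _ fun _ => hM _)

/-- For `F z = E[g (X + R z)]` there is a bounded linear form `L`, the expectation
`L w = E[g (X + R z) W w]`, that is the derivative of `F` at `z`, with a quadratic remainder
that does not depend on `z`. -/
lemma IsIsonormal.exists_taylor [CompleteSpace H] [SecondCountableTopology H]
    [IsProbabilityMeasure P]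
    (hW : IsIsonormal P W) (hR : R.IsPositive) (hX : IsImageOf R W X) (hg : Measurable g)
    (hM0 : 0 ≤ M) (hM : ∀ y, |g y| ≤ M) (z : H) :
    ∃ L : H →L[ℝ] ℝ, ‖L‖ ≤ M ∧ ∀ w : H, ‖w‖ ≤ 1 →
      |∫ ω, g (X ω + R (z + w)) ∂P - ∫ ω, g (X ω + R z) ∂P - L w|
        ≤ M * (4 * Real.exp 2) * ‖w‖ ^ 2 := by
  set G : Lp ℝ 2 P := (memLp_comp_add hX hg hM (R z)).toLp with hGdef
  have hG : G =ᵐ[P] fun ω => g (X ω + R z) := MemLp.coeFn_toLp _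
  have hGn : ‖G‖ ≤ M := by
    have := Lp.norm_le_of_ae_bound (f := G) hM0 (by
      filter_upwards [hG] with ω hω
      rw [hω]; exact hM _)
    simpa [measureUnivNNReal] using this
  refine ⟨(innerSL ℝ G).comp W.toContinuousLinearMap, ?_, fun w hw => ?_⟩
  · refine ContinuousLinearMap.opNorm_le_bound _ hM0 fun w => ?_
    change |⟪G, W w⟫| ≤ _
    refine (abs_real_inner_le_norm _ _).trans ?_
    rw [W.norm_map]
    gcongr
  · have hmeas : AEStronglyMeasurable (fun ω => g (X ω + R z)) P :=
      (memLp_comp_add hX hg hM (R z)).1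
    have hb : ∀ᵐ ω ∂P, ‖g (X ω + R z)‖ ≤ M := ae_of_all _ fun _ => hM _
    have hi1 : Integrable (fun ω => cmDensity W w ω * g (X ω + R z)) P :=
      (hW.integrable_cmDensity w).mul_bdd hmeas hb
    have hi2 : Integrable (fun ω => g (X ω + R z)) P :=
      (memLp_comp_add hX hg hM (R z)).integrable (by norm_num)
    have hWi : Integrable (W w) P := (Lp.memLp (W w)).integrable (by norm_num)
    have hi3 : Integrable (fun ω => W w ω * g (X ω + R z)) P := hWi.mul_bdd hmeas hb
    have h1 : ∫ ω, g (X ω + R (z + w)) ∂P = ∫ ω, cmDensity W w ω * g (X ω + R z) ∂P := by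
      -- The translated function `y ↦ g (y + R z)` has the same bound as `g`, whatever `z` is.
      rw [← hW.integral_comp_add hR hX w (g := fun y => g (y + R z)) (by fun_prop)]
      refine integral_congr_ae (ae_of_all _ fun ω => ?_)
      simp only [map_add]
      congr 1
      abel
    have h2 : (innerSL ℝ G).comp W.toContinuousLinearMap w = ∫ ω, W w ω * g (X ω + R z) ∂P := by
      change ⟪G, W w⟫ = _
      rw [L2.inner_def]
      refine integral_congr_ae ?_
      filter_upwards [hG] with ω hω
      rw [hω]
      simp
    have hi12 : Integrable (fun ω => cmDensity W w ω * g (X ω + R z) - g (X ω + R z)) P :=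
      hi1.sub hi2
    rw [h1, h2, ← integral_sub hi1 hi2, ← integral_sub hi12 hi3]
    have hbd : ∀ ω, ‖cmDensity W w ω * g (X ω + R z) - g (X ω + R z) - W w ω * g (X ω + R z)‖
        ≤ M * |cmDensity W w ω - 1 - W w ω| := fun ω => by
      rw [Real.norm_eq_abs, ← sub_one_mul, ← sub_mul, abs_mul, mul_comm]
      exact mul_le_mul_of_nonneg_right (hM _) (abs_nonneg _)
    refine (norm_integral_le_of_norm_le (g := fun ω => M * |cmDensity W w ω - 1 - W w ω|) ?_
      (ae_of_all _ hbd)).trans ?_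
    · exact ((((hW.integrable_cmDensity w).sub (integrable_const 1)).sub hWi).abs).const_mul M
    · rw [integral_const_mul, mul_assoc]
      gcongr
      exact hW.integral_abs_cmDensity_sub_le hw

end Representation

/-! ### Functions with a uniform first order Taylor expansion -/

section Taylor

variable {E : Type*} [NormedAddCommGroup E] [NormedSpace ℝ E] {F : E → ℝ} {L : E → E →L[ℝ] ℝ}
  {c : ℝ}

lemma hasFDerivAt_of_taylor
    (h : ∀ z w : E, ‖w‖ ≤ 1 → |F (z + w) - F z - L z w| ≤ c * ‖w‖ ^ 2) (z : E) :
    HasFDerivAt F (L z) z := by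
  rw [hasFDerivAt_iff_isLittleO_nhds_zero]
  have h1 : (fun w => F (z + w) - F z - L z w) =O[𝓝 0] fun w : E => ‖w‖ ^ 2 := by
    refine Asymptotics.IsBigO.of_bound c ?_
    filter_upwards [Metric.closedBall_mem_nhds (0 : E) one_pos] with w hw
    rw [Real.norm_eq_abs, norm_pow, norm_norm]
    exact h z w (by simpa using hw)
  exact h1.trans_isLittleO (Asymptotics.isLittleO_norm_pow_id one_lt_two)

/-- Comparing the expansions at `z` and at `z + w` along a vector of norm `‖w‖` shows that the
derivative is locally Lipschitz, with a uniform constant. -/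
lemma norm_sub_le_of_taylor
    (h : ∀ z w : E, ‖w‖ ≤ 1 → |F (z + w) - F z - L z w| ≤ c * ‖w‖ ^ 2) (hc : 0 ≤ c) (z w : E)
    (hw : ‖w‖ ≤ 1 / 2) : ‖L (z + w) - L z‖ ≤ 6 * c * ‖w‖ := by
  rcases eq_or_ne w 0 with rfl | hw0
  · simp
  have hwp : 0 < ‖w‖ := norm_pos_iff.2 hw0
  refine ContinuousLinearMap.opNorm_le_of_unit_norm (by positivity) fun k hk => ?_
  set k' : E := ‖w‖ • k with hk'
  have hk'n : ‖k'‖ = ‖w‖ := by rw [hk', norm_smul, hk, mul_one, norm_norm]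
  have h1 := h (z + w) k' (by rw [hk'n]; linarith)
  have h2 := h z w (by linarith)
  have hs : ‖w + k'‖ ≤ 2 * ‖w‖ := (norm_add_le _ _).trans (by rw [hk'n]; linarith)
  have h3 := h z (w + k') (by linarith)
  have h4 : c * ‖w + k'‖ ^ 2 ≤ c * (2 * ‖w‖) ^ 2 := by gcongr
  rw [hk'n] at h1
  rw [← add_assoc, map_add] at h3
  -- `F (z + w + k') - F (z + w)` is expanded at `z + w` by `h1`, and at `z` by `h3` and `h2`; the
  -- remainders add up to at most `(1 + 1 + 4) c ‖w‖²`.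
  have h5 : |(L (z + w) - L z) k'| ≤ 6 * c * ‖w‖ * ‖w‖ := by
    rw [sub_apply]
    rw [abs_le] at h1 h2 h3 ⊢
    constructor <;> nlinarith
  rw [hk', map_smul, smul_eq_mul, abs_mul, abs_norm, mul_comm] at h5
  exact le_of_mul_le_mul_right h5 hwp

lemma uniformContinuous_of_taylor
    (h : ∀ z w : E, ‖w‖ ≤ 1 → |F (z + w) - F z - L z w| ≤ c * ‖w‖ ^ 2) (hc : 0 ≤ c) :
    UniformContinuous L := by
  rw [Metric.uniformContinuous_iff]
  intro ε hε
  refine ⟨min (1 / 2) (ε / (6 * c + 1)), by positivity, fun {a b} hab => ?_⟩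
  rw [dist_eq_norm] at hab ⊢
  have h1 := norm_sub_le_of_taylor h hc b (a - b) (hab.le.trans (min_le_left _ _))
  rw [add_sub_cancel] at h1
  have h2 := (lt_div_iff₀ (by positivity)).1 (hab.trans_le (min_le_right _ _))
  nlinarith [norm_nonneg (a - b)]

end Taylor

/-! ### The pseudoinverse -/

section PseudoInverse

variable {H : Type*} [NormedAddCommGroup H] [InnerProductSpace ℝ H] [CompleteSpace H]

/-- A vector orthogonal to the kernel of `R` is the pseudoinverse of its image. -/
lemma eq_pseudoInv {R : H →L[ℝ] H} {z : H} (hz : ∀ w, R w = 0 → ⟪w, z⟫ = 0) :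
    z = pseudoInv R (R z) := by
  obtain ⟨h1, h2⟩ := pseudoInv_spec R (mem_range_self z)
  have h3 : R (z - pseudoInv R (R z)) = 0 := by rw [map_sub, h2, sub_self]
  have h4 : ⟪z - pseudoInv R (R z), z - pseudoInv R (R z)⟫ = 0 := by
    rw [inner_sub_right, hz _ h3, h1 _ h3, sub_zero]
  exact sub_eq_zero.1 (inner_self_eq_zero.1 h4)

/-- If the range of `A` lies in the range of `R` and `pseudoInv R ∘ A` is bounded, then this map
is a continuous linear factor of `A` through `R`. -/
lemma exists_factor_through {R A : H →L[ℝ] H} (hrange : range A ⊆ range R) {K : ℝ} (hK0 : 0 ≤ K)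
    (hK : ∀ x, ‖pseudoInv R (A x)‖ ≤ K * ‖x‖) :
    ∃ Λ : H →L[ℝ] H, ‖Λ‖ ≤ K ∧ ∀ x, R (Λ x) = A x := by
  have hspec : ∀ x, _ := fun x => pseudoInv_spec R (hrange (mem_range_self x))
  let Λ : H →ₗ[ℝ] H :=
    { toFun := fun x => pseudoInv R (A x)
      map_add' := fun x y => by
        have h := eq_pseudoInv (R := R) (z := pseudoInv R (A x) + pseudoInv R (A y))
          fun w hw => by rw [inner_add_right, (hspec x).1 w hw, (hspec y).1 w hw, add_zero]
        rw [h, map_add R, (hspec x).2, (hspec y).2, map_add]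
      map_smul' := fun a x => by
        have h := eq_pseudoInv (R := R) (z := a • pseudoInv R (A x))
          fun w hw => by rw [real_inner_smul_right, (hspec x).1 w hw, mul_zero]
        rw [RingHom.id_apply, h, map_smul R, (hspec x).2, map_smul] }
  exact ⟨Λ.mkContinuous K hK, Λ.mkContinuous_norm_le hK0 hK, fun x => (hspec x).2⟩

end PseudoInverse

/-! ### The half-space and the odd extension -/

section HalfSpace

variable {H : Type*} [NormedAddCommGroup H] [InnerProductSpace ℝ H]

lemma isOpen_halfSpace (ybar : H) : IsOpen (halfSpace ybar) :=
  isOpen_lt continuous_const (by fun_prop)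

lemma convex_halfSpace (ybar : H) : Convex ℝ (halfSpace ybar) := by
  refine convex_halfSpace_gt (f := fun x => ⟪x, ybar⟫) ⟨?_, ?_⟩ 0
  · intro x y; exact inner_add_left _ _ _
  · intro a x; exact real_inner_smul_left _ _ _

lemma mem_halfSpace_self {ybar : H} (hy : ‖ybar‖ = 1) : ybar ∈ halfSpace ybar := by
  change 0 < ⟪ybar, ybar⟫
  rw [real_inner_self_eq_norm_sq, hy]
  norm_num

lemma uniqueDiffOn_closure_halfSpace {ybar : H} (hy : ‖ybar‖ = 1) :
    UniqueDiffOn ℝ (closure (halfSpace ybar)) :=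
  uniqueDiffOn_convex (convex_halfSpace ybar).closure
    ⟨ybar, interior_mono subset_closure
      ((isOpen_halfSpace ybar).interior_eq.symm ▸ mem_halfSpace_self hy)⟩

lemma abs_oddExt_le {ybar : H} {f : halfSpace ybar → ℝ} (hf : ∃ M : ℝ, ∀ x, |f x| ≤ M)
    (x : H) : |oddExt ybar f x| ≤ supNorm f := by
  obtain ⟨M, hM⟩ := hf
  have hle : ∀ x, |f x| ≤ supNorm f := fun x =>
    le_ciSup (f := fun x => |f x|) ⟨M, by rintro _ ⟨x, rfl⟩; exact hM x⟩ x
  unfold oddExt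
  split_ifs
  · exact hle _
  · rw [abs_neg]; exact hle _
  · rw [abs_zero]; exact Real.iSup_nonneg fun _ => abs_nonneg _

lemma measurable_oddExt [MeasurableSpace H] [BorelSpace H] {ybar : H} {f : halfSpace ybar → ℝ}
    (hf : Measurable f) : Measurable (oddExt ybar f) := by
  classical
  have hs : MeasurableSet (halfSpace ybar) := (isOpen_halfSpace ybar).measurableSet
  have hr : Continuous (reflect ybar) := by unfold reflect; fun_prop
  have hext : Measurable fun x => if h : x ∈ halfSpace ybar then f ⟨x, h⟩ else 0 :=
    Measurable.dite hf measurable_const hs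
  have heq : oddExt ybar f = (halfSpace ybar).piecewise
      (fun x => if h : x ∈ halfSpace ybar then f ⟨x, h⟩ else 0)
      (fun x => -(if h : reflect ybar x ∈ halfSpace ybar then f ⟨reflect ybar x, h⟩ else 0)) := by
    ext x
    unfold oddExt Set.piecewise
    split_ifs <;> simp_all
  rw [heq]
  exact hext.piecewise hs (hext.comp hr.measurable).neg

variable [CompleteSpace H]

/-- A function with a bounded and uniformly continuous derivative on the whole space restricts to
a function of class `UC¹_b` on any set of unique differentiability, with the same gradient. -/
lemma isUCb1_restrict {s : Set H} (hs : UniqueDiffOn ℝ s) {G : H → ℝ} {D : H → H →L[ℝ] ℝ}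
    (hD : ∀ x, HasFDerivAt G (D x) x) {M N : ℝ} (hM : ∀ x, |G x| ≤ M) (hN0 : 0 ≤ N)
    (hN : ∀ x, ‖D x‖ ≤ N) (hDu : UniformContinuous D) :
    IsUCb1 (s.domRestrict G) ∧ ∀ x : s, ‖gradOn (s.domRestrict G) x‖ ≤ N := by
  have hext : ∀ x ∈ s, Function.extend Subtype.val (s.domRestrict G) 0 x = G x := fun x hx =>
    Subtype.val_injective.extend_apply (s.domRestrict G) 0 ⟨x, hx⟩
  have hwithin : ∀ x ∈ s, HasFDerivWithinAt
      (Function.extend Subtype.val (s.domRestrict G) 0) (D x) s x := fun x hx =>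
    (hD x).hasFDerivWithinAt.congr hext (hext x hx)
  have hgrad : ∀ x : s, gradOn (s.domRestrict G) x = (InnerProductSpace.toDual ℝ H).symm (D x) :=
    fun x => by
      rw [gradOn, gradientWithin, (hwithin x x.2).fderivWithin (hs x x.2)]
  have hbound : ∀ x : s, ‖gradOn (s.domRestrict G) x‖ ≤ N := fun x => by
    rw [hgrad, LinearIsometryEquiv.norm_map]
    exact hN x
  have hlip : LipschitzWith ⟨N, hN0⟩ G :=
    lipschitzWith_of_nnnorm_fderiv_le (𝕜 := ℝ) (fun x => (hD x).differentiableAt) fun x => by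
      rw [(hD x).fderiv]; exact hN x
  refine ⟨⟨⟨M, fun x => hM x⟩, ?_, fun x hx => (hwithin x hx).differentiableWithinAt,
    ⟨N, hbound⟩, ?_⟩, hbound⟩
  · exact hlip.uniformContinuous.comp uniformContinuous_subtype_val
  · rw [funext hgrad]
    exact (InnerProductSpace.toDual ℝ H).symm.isometry.uniformContinuous.comp
      (hDu.comp uniformContinuous_subtype_val)

end HalfSpace

/-! ### Smoothing by the Ornstein-Uhlenbeck semigroup -/

section Smoothing

variable {H : Type*} [NormedAddCommGroup H] [InnerProductSpace ℝ H] [CompleteSpace H]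
  [TopologicalSpace.SeparableSpace H] [MeasurableSpace H] [BorelSpace H]

/-- The operator `A` stands for `S t` and `B` for the covariance `Q_t`. If `Λ` is a bounded
factor of `A` through the square root of `B`, then `x ↦ ∫ g dN(A x, B)` has a uniformly continuous
derivative, bounded by `‖Λ‖ sup |g|`. -/
lemma exists_hasFDerivAt_integral_gaussian {A B Λ : H →L[ℝ] H} (hB : B.IsPositive)
    (htr : IsTraceClass B) (hΛ : ∀ x, posSqrt B (Λ x) = A x) {g : H → ℝ} (hg : Measurable g)
    {M : ℝ} (hM : ∀ y, |g y| ≤ M) :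
    ∃ D : H → H →L[ℝ] ℝ, UniformContinuous D ∧ (∀ x, ‖D x‖ ≤ M * ‖Λ‖) ∧
      (∀ x, HasFDerivAt (fun x => ∫ y, g y ∂gaussian (A x) B) (D x) x) ∧
      ∀ x, |∫ y, g y ∂gaussian (A x) B| ≤ M := by
  have hM0 : 0 ≤ M := (abs_nonneg _).trans (hM 0)
  have : SecondCountableTopology H := UniformSpace.secondCountable_of_separable H
  obtain ⟨hR, hRR⟩ := posSqrt_spec hB
  set R := posSqrt B
  obtain ⟨ι, e, -⟩ := exists_hilbertBasis ℝ H
  have hHS : Summable fun i => ‖R (e i)‖ ^ 2 := by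
    simp only [norm_sq_eq_inner_comp hR, hRR]
    exact summable_inner_of_isTraceClass hB htr e.orthonormal
  have hW := isIsonormal_isonormalOfBasis e
  obtain ⟨X, hX⟩ := exists_isImageOf (isonormalOfBasis e) e hR hHS
  have hF : ∀ x, ∫ y, g y ∂gaussian (A x) B = ∫ ω, g (X ω + R (Λ x)) ∂stdGaussianPi ι := by
    intro x
    rw [← hRR, gaussian_eq_map_add hW hR hX, hΛ,
      integral_map (hX.1.aemeasurable.add_const _) hg.aestronglyMeasurable]
  choose L hLn hL using hW.exists_taylor hR hX hg hM0 hM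
  have hder := hasFDerivAt_of_taylor (F := fun z => ∫ ω, g (X ω + R z) ∂stdGaussianPi ι) hL
  have huc := uniformContinuous_of_taylor (F := fun z => ∫ ω, g (X ω + R z) ∂stdGaussianPi ι) hL
    (by positivity)
  refine ⟨fun x => (L (Λ x)).comp Λ, ?_, fun x => ?_, fun x => ?_, fun x => ?_⟩
  · exact ((ContinuousLinearMap.compL ℝ H H ℝ).flip Λ).uniformContinuous.comp
      (huc.comp Λ.uniformContinuous)
  · refine ((L (Λ x)).opNorm_comp_le Λ).trans ?_
    gcongr
    exact hLn _
  · rw [funext hF]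
    exact (hder (Λ x)).comp x Λ.hasFDerivAt
  · rw [hF]
    have := norm_integral_le_of_norm_le_const (μ := stdGaussianPi ι)
      (f := fun ω => g (X ω + R (Λ x))) (ae_of_all _ fun _ => hM _)
    simpa using this

end Smoothing

end HalfSpaceOU

theorem proposition2p9 {H : Type*} [NormedAddCommGroup H] [InnerProductSpace ℝ H]
    [CompleteSpace H] [TopologicalSpace.SeparableSpace H] [MeasurableSpace H] [BorelSpace H]
    (ybar : H) (hybar : ‖ybar‖ = 1)
    (Q : H →L[ℝ] H) (hQpos : Q.IsPositive) (hQtr : HalfSpaceOU.IsTraceClass Q)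
    (A : H →ₗ.[ℝ] H) (S : ℝ → H →L[ℝ] H)
    (hS : HalfSpaceOU.IsC0Semigroup S) (hA : HalfSpaceOU.IsGenerator A S)
    (hα : ∃ α : ℝ, (ybar, α • ybar) ∈ A.graph ∧ (ybar, α • ybar) ∈ A.adjoint.graph)
    (hlam : ∃ lam : ℝ, 0 < lam ∧ Q ybar = lam • ybar)
    (hcomm : ∀ t : ℝ, 0 ≤ t → S t ∘L Q = Q ∘L S t)
    (hQt : ∀ t : ℝ, 0 < t → HalfSpaceOU.IsTraceClass (HalfSpaceOU.covOp S Q t))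
    (hγ : ∃ γ : ℝ, 0 < γ ∧ γ < 1 ∧ ∀ t : ℝ, 0 < t → HalfSpaceOU.IsTraceClass
      (∫ s in (0 : ℝ)..t, s ^ (-γ) • HalfSpaceOU.covIntegrand S Q s))
    (hrange : ∀ t : ℝ, 0 < t →
      Set.range (S t) ⊆ Set.range (HalfSpaceOU.posSqrt (HalfSpaceOU.covOp S Q t)))
    (T : ℝ) (hT : 0 < T) (δ : ℝ) (hδ0 : 0 < δ) (hδ1 : δ < 1)
    (hΛ : ∃ K : ℝ, 0 < K ∧ ∀ t : ℝ, 0 < t → t ≤ T → ∀ x : H,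
      ‖HalfSpaceOU.pseudoInv (HalfSpaceOU.posSqrt (HalfSpaceOU.covOp S Q t)) (S t x)‖
        ≤ K * t ^ (-δ) * ‖x‖) :
    ∃ C : ℝ, 0 < C ∧ ∀ f : HalfSpaceOU.halfSpace ybar → ℝ,
      HalfSpaceOU.IsBoundedMeasurable f → ∀ t : ℝ, 0 < t → t ≤ T →
        HalfSpaceOU.IsUCb1 (HalfSpaceOU.halfSemigroup S Q ybar t f) ∧
        ∀ x : closure (HalfSpaceOU.halfSpace ybar), (x : H) ∈ HalfSpaceOU.halfSpace ybar →
          ‖HalfSpaceOU.gradOn (HalfSpaceOU.halfSemigroup S Q ybar t f) x‖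
            ≤ C / t ^ δ * HalfSpaceOU.supNorm f := by
  obtain ⟨K, hK0, hK⟩ := hΛ
  refine ⟨K, hK0, fun f hf t ht htT => ?_⟩
  have hB := HalfSpaceOU.covOp_isPositive (S := S) hQpos ht.le
  have hKt : 0 ≤ K * t ^ (-δ) := by positivity
  obtain ⟨Λ, hΛn, hΛ⟩ := HalfSpaceOU.exists_factor_through (hrange t ht) hKt (hK t ht htT)
  have hM := HalfSpaceOU.abs_oddExt_le hf.2
  have hM0 : 0 ≤ HalfSpaceOU.supNorm f := (abs_nonneg _).trans (hM 0)
  obtain ⟨D, hDu, hDn, hD, hbd⟩ := HalfSpaceOU.exists_hasFDerivAt_integral_gaussian hB (hQt t ht)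
    hΛ (HalfSpaceOU.measurable_oddExt hf.1) hM
  have hle : HalfSpaceOU.supNorm f * ‖Λ‖ ≤ K / t ^ δ * HalfSpaceOU.supNorm f := by
    rw [mul_comm, div_eq_mul_inv, ← Real.rpow_neg ht.le]
    gcongr
  have h := HalfSpaceOU.isUCb1_restrict (HalfSpaceOU.uniqueDiffOn_closure_halfSpace hybar) hD hbd
    (mul_nonneg hM0 (norm_nonneg Λ)) hDn hDu
  exact ⟨h.1, fun x _ => (h.2 x).trans hle⟩
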